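/- Let $n\ge 3$ and let $X_1,\dots,X_n$ be independent, identically distributed random variables whose common distribution $F$ is concentrated on $(0,\infty)$ and has a density that is positive and continuous on $(0,\infty)$. Let $X_{(1)}\le X_{(2)}\le\cdots\le X_{(n)}$ be the order statistics of $X_1,\dots,X_n$ and let $\overline X_n=\frac1n\sum_{i=1}^n X_i$ be the sample mean. Suppose that the real numbers $p$ and $a_{i,j}\ge 0$, $1\le i,j\le n$, are such that $p>0$ and $a_{1,n}+a_{n,1}>0$, and put $$Z_n=\sum_{i=1}^n\sum_{j=1}^n a_{i,j}\,|X_{(i)}-X_{(j)}|^p .$$ Then $\overline X_n$ and $(Z_n)^{1/p}/\overline X_n$ are independent if and only if $F$ is a gamma distribution, that is, if and only if there are $a>0$ and $b>0$ such that $F$ has the density $f(x)=\frac{1}{\Gamma(a)\,b^a}\,x^{a-1}e^{-x/b}$ for $x>0$ and $f(x)=0$ for $x\le 0$. -/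

import Mathlib

open MeasureTheory ProbabilityTheory

/-- The order statistics `x_(1) ≤ x_(2) ≤ ⋯ ≤ x_(n)` of a real tuple: its nondecreasing
rearrangement. With `0`-based indices, `orderStat x i` is `x_(i+1)`. -/
noncomputable def orderStat {n : ℕ} (x : Fin n → ℝ) : Fin n → ℝ :=
  x ∘ Tuple.sort x

/-- The arithmetic mean of a real tuple. -/
noncomputable def sampleMean {n : ℕ} (x : Fin n → ℝ) : ℝ :=
  (∑ i, x i) / (n : ℝ)

/-- The statistic `∑ᵢ ∑ⱼ aᵢⱼ |x_(i) - x_(j)| ^ p`. -/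
noncomputable def weightedSpread {n : ℕ} (a : Fin n → Fin n → ℝ) (p : ℝ) (x : Fin n → ℝ) : ℝ :=
  ∑ i, ∑ j, a i j * |orderStat x i - orderStat x j| ^ p

/-- `F` is a gamma distribution with some shape `a > 0` and some scale `b > 0`, that is, with
density `x ^ (a - 1) * exp (-x / b) / (Γ(a) * b ^ a)` on `(0, ∞)`. The second parameter of
`gammaMeasure` is the rate, the inverse of the scale. -/
def IsGammaDistribution (F : Measure ℝ) : Prop :=
  ∃ a b : ℝ, 0 < a ∧ 0 < b ∧ F = gammaMeasure a b⁻¹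

/-- `F` is concentrated on `(0, ∞)` and has there a density that is positive and continuous on
`(0, ∞)`. -/
def HasPositiveContinuousDensity (F : Measure ℝ) : Prop :=
  ∃ f : ℝ → ℝ, ContinuousOn f (Set.Ioi 0) ∧ (∀ x, 0 < x → 0 < f x) ∧
    F = (volume.restrict (Set.Ioi 0)).withDensity (fun x => ENNReal.ofReal (f x))

open scoped ENNReal
open Filter Topology

/-! Write a positive sample as its mean `s` times its shape `w`, a tuple of mean one. In these
coordinates Lebesgue measure on the orthant is a product (`map_sampleMean_shape`), so `(s, w)` has
density `∏ f (s * w i)` against a product measure. A gamma density makes this factor into a function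
of `s` times a function of `w`; the mean is then independent of the whole shape, and the spread
ratio, by homogeneity, depends on the shape alone.

Conversely, independence only concerns integrals of that density over sets defined by the spread. It
makes the integrals over small sublevel sets `A k` mutually proportional as functions of `s`. As `A
k` shrinks to the constant tuple, the averages tend to `f s ^ n`, so the integral over `A k` is `K k
* f s ^ n` for some constant `K k`.

Since `f` is merely continuous, local comparison replaces Taylor expansion. Put `Q k c = ∫ exp (c *
logSum w)` over `A k`. A local maximum of `log f t - c * log t - d * t` forces `K k ≤ Q k c` for
large `k`, whatever `d`, because linear terms cancel on mean one; a local minimum forces the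
reverse. So `log f - c * log` is convex if `Q k c < K k` infinitely often, and concave if `K k < Q k
c` infinitely often. As `Q k` is strictly decreasing, at most one `c` escapes both. Connectedness of
the line then gives a `c` with both properties (`exists_eq_log_add_affine`), so `log f - c * log` is
affine, and integrability identifies a gamma density. -/

theorem lintegral_pi_prod {n : ℕ} (μ : Fin n → Measure ℝ) [∀ i, SigmaFinite (μ i)]
    (f : Fin n → ℝ → ℝ≥0∞) (hf : ∀ i, Measurable (f i)) :
    ∫⁻ x, ∏ i, f i (x i) ∂Measure.pi μ = ∏ i, ∫⁻ t, f i t ∂μ i := by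
  induction n with
  | zero => simp
  | succ n ih =>
    have h := (measurePreserving_piFinSuccAbove μ 0).symm
    rw [← h.lintegral_comp_emb (MeasurableEquiv.measurableEmbedding _), Fin.prod_univ_succ]
    simp only [Fin.prod_univ_succ]
    rw [← ih (fun i => μ i.succ) (fun i => f i.succ) (fun i => hf _), ← lintegral_prod_mul]
    · rfl
    · exact (hf 0).aemeasurable
    · exact (Finset.measurable_prod _ fun i _ => (hf _).comp (measurable_pi_apply i)).aemeasurable

theorem pi_withDensity {n : ℕ} (f : ℝ → ℝ≥0∞) (hf : Measurable f)
    [SigmaFinite ((volume : Measure ℝ).withDensity f)] :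
    Measure.pi (fun _ : Fin n => (volume : Measure ℝ).withDensity f) =
      volume.withDensity (fun x : Fin n → ℝ => ∏ i, f (x i)) := by
  refine Measure.pi_eq fun s hs => ?_
  rw [withDensity_apply _ (MeasurableSet.univ_pi hs), volume_pi, Measure.restrict_pi_pi,
    lintegral_pi_prod _ (fun _ => f) fun _ => hf]
  exact Finset.prod_congr rfl fun i _ => (withDensity_apply _ (hs i)).symm

/-! ### Polar decomposition of Lebesgue measure into mean and shape -/

theorem measurable_sampleMean {n : ℕ} : Measurable (sampleMean : (Fin n → ℝ) → ℝ) := by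
  unfold sampleMean; fun_prop

theorem sampleMean_smul {n : ℕ} (c : ℝ) (x : Fin n → ℝ) :
    sampleMean (c • x) = c * sampleMean x := by
  simp only [sampleMean, Pi.smul_apply, smul_eq_mul, ← Finset.mul_sum, mul_div_assoc]

/-- The open positive orthant. -/
def positiveOrthant (n : ℕ) : Set (Fin n → ℝ) := {x | ∀ i, 0 < x i}

theorem isOpen_positiveOrthant (n : ℕ) : IsOpen (positiveOrthant n) := by
  simp only [positiveOrthant, Set.ofPred_forall]
  exact isOpen_iInter_of_finite fun i => isOpen_lt continuous_const (continuous_apply i)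

theorem sampleMean_pos {n : ℕ} [NeZero n] {x : Fin n → ℝ} (hx : x ∈ positiveOrthant n) :
    0 < sampleMean x :=
  div_pos (Finset.sum_pos (fun i _ => hx i) Finset.univ_nonempty)
    (Nat.cast_pos.2 (NeZero.pos n))

/-- A tuple divided by its mean. -/
noncomputable def shape {n : ℕ} (x : Fin n → ℝ) : Fin n → ℝ := (sampleMean x)⁻¹ • x

theorem measurable_shape {n : ℕ} : Measurable (shape : (Fin n → ℝ) → Fin n → ℝ) :=
  measurable_sampleMean.inv.smul measurable_id

theorem shape_smul {n : ℕ} {c : ℝ} (hc : 0 < c) (x : Fin n → ℝ) : shape (c • x) = shape x := by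
  rw [shape, shape, sampleMean_smul, smul_smul, mul_inv_rev, mul_assoc, inv_mul_cancel₀ hc.ne',
    mul_one]

theorem sampleMean_smul_shape {n : ℕ} [NeZero n] {x : Fin n → ℝ} (hx : x ∈ positiveOrthant n) :
    sampleMean x • shape x = x := by
  rw [shape, smul_smul, mul_inv_cancel₀ (sampleMean_pos hx).ne', one_smul]

theorem shape_mem {n : ℕ} [NeZero n] {x : Fin n → ℝ} (hx : x ∈ positiveOrthant n) :
    shape x ∈ positiveOrthant n := fun i => mul_pos (inv_pos.2 (sampleMean_pos hx)) (hx i)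

theorem sampleMean_shape {n : ℕ} [NeZero n] {x : Fin n → ℝ} (hx : x ∈ positiveOrthant n) :
    sampleMean (shape x) = 1 := by
  rw [shape, sampleMean_smul, inv_mul_cancel₀ (sampleMean_pos hx).ne']

theorem sampleMean_eq_one_iff {n : ℕ} [NeZero n] {x : Fin n → ℝ} :
    sampleMean x = 1 ↔ ∑ i, (x i - 1) = 0 := by
  have : (n : ℝ) ≠ 0 := NeZero.ne _
  rw [sampleMean, div_eq_one_iff_eq this, Finset.sum_sub_distrib]
  simp [sub_eq_zero]

/-- The part of the positive orthant where the mean is at most one. -/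
def unitCone (n : ℕ) : Set (Fin n → ℝ) := positiveOrthant n ∩ {x | sampleMean x ≤ 1}

theorem measurableSet_unitCone (n : ℕ) : MeasurableSet (unitCone n) :=
  (isOpen_positiveOrthant n).measurableSet.inter
    (measurableSet_le measurable_sampleMean measurable_const)

theorem volume_unitCone_lt_top (n : ℕ) [NeZero n] : volume (unitCone n) < ∞ := by
  refine (measure_mono (t := Set.Icc 0 (fun _ => (n : ℝ))) ?_).trans_lt
    isCompact_Icc.measure_lt_top
  intro x hx
  have hn : (0 : ℝ) < n := Nat.cast_pos.2 (NeZero.pos n)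
  refine ⟨fun i => (hx.1 i).le, fun i => ?_⟩
  have h1 : (∑ i, x i) / (n : ℝ) ≤ 1 := hx.2
  rw [div_le_one hn] at h1
  exact (Finset.single_le_sum (f := x) (fun j _ => (hx.1 j).le) (Finset.mem_univ i)).trans h1

/-- The law of the shape under the volume of the unit cone. -/
noncomputable def shapeMeasure (n : ℕ) : Measure (Fin n → ℝ) :=
  (volume.restrict (unitCone n)).map shape

instance (n : ℕ) [NeZero n] : IsFiniteMeasure (shapeMeasure n) := by
  have : IsFiniteMeasure ((volume : Measure (Fin n → ℝ)).restrict (unitCone n)) :=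
    ⟨by simpa using volume_unitCone_lt_top n⟩
  unfold shapeMeasure; infer_instance

theorem shapeMeasure_apply {n : ℕ} {A : Set (Fin n → ℝ)} (hA : MeasurableSet A) :
    shapeMeasure n A = volume (unitCone n ∩ shape ⁻¹' A) := by
  rw [shapeMeasure, Measure.map_apply measurable_shape hA,
    Measure.restrict_apply (measurable_shape hA), Set.inter_comm]

theorem ae_shapeMeasure (n : ℕ) [NeZero n] :
    ∀ᵐ w ∂shapeMeasure n, w ∈ positiveOrthant n ∧ sampleMean w = 1 := by
  have hm : MeasurableSet {w : Fin n → ℝ | w ∈ positiveOrthant n ∧ sampleMean w = 1} :=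
    (isOpen_positiveOrthant n).measurableSet.inter
      (measurableSet_eq_fun measurable_sampleMean measurable_const)
  rw [shapeMeasure, ae_map_iff measurable_shape.aemeasurable hm]
  filter_upwards [ae_restrict_mem (measurableSet_unitCone n)] with x hx
  exact ⟨shape_mem hx.1, sampleMean_shape hx.1⟩

/-- The radial part of Lebesgue measure on the positive orthant. -/
noncomputable def radialMeasure (n : ℕ) : Measure ℝ :=
  (volume.restrict (Set.Ioi 0)).withDensity (fun s => ENNReal.ofReal (n * s ^ (n - 1)))

theorem radialMeasure_Iic (n : ℕ) [NeZero n] (t : ℝ) :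
    radialMeasure n (Set.Iic t) = ENNReal.ofReal (max t 0 ^ n) := by
  rw [radialMeasure, withDensity_apply _ measurableSet_Iic, Measure.restrict_restrict
    measurableSet_Iic, Set.inter_comm, Set.Ioi_inter_Iic]
  rcases le_total t 0 with ht | ht
  · simp [Set.Ioc_eq_empty (not_lt.2 ht), max_eq_right ht, NeZero.ne n]
  · rw [← ofReal_integral_eq_lintegral_ofReal, ← intervalIntegral.integral_of_le ht,
      intervalIntegral.integral_const_mul, integral_pow, max_eq_left ht]
    · have hn : 1 ≤ n := NeZero.one_le
      have hn' : (n : ℝ) ≠ 0 := NeZero.ne _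
      congr 1
      rw [Nat.cast_sub hn, Nat.sub_add_cancel hn, zero_pow (NeZero.ne n)]
      simp [mul_div_cancel_left₀, hn', mul_div_assoc']
    · exact (Continuous.integrableOn_Icc (by fun_prop)).mono_set Set.Ioc_subset_Icc_self
    · filter_upwards [ae_restrict_mem measurableSet_Ioc] with s hs
      have := hs.1.le
      positivity

instance (n : ℕ) : SigmaFinite (radialMeasure n) := by
  unfold radialMeasure; infer_instance

/-- The shape is invariant under dilation, so for `t > 0` the truncated cone is `t` times the one at
height one, and Lebesgue measure scales by `t ^ n`. For `t ≤ 0` it is empty. -/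
theorem volume_cone {n : ℕ} [NeZero n] {A : Set (Fin n → ℝ)} (hA : MeasurableSet A) {t : ℝ} :
    volume (positiveOrthant n ∩ {x | sampleMean x ≤ t} ∩ shape ⁻¹' A) =
      ENNReal.ofReal (max t 0 ^ n) * shapeMeasure n A := by
  rcases le_or_gt t 0 with ht | ht
  · rw [max_eq_right ht, zero_pow (NeZero.ne n), ENNReal.ofReal_zero, zero_mul]
    convert measure_empty (μ := (volume : Measure (Fin n → ℝ)))
    ext x
    simp only [Set.mem_inter_iff, Set.mem_ofPred_eq, Set.mem_empty_iff_false, iff_false]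
    rintro ⟨⟨hx, hxt⟩, -⟩
    exact absurd (sampleMean_pos hx) (not_lt.2 (hxt.trans ht))
  · rw [max_eq_left ht.le, shapeMeasure_apply hA]
    have := Measure.addHaar_smul_of_nonneg (volume : Measure (Fin n → ℝ)) ht.le
      (unitCone n ∩ shape ⁻¹' A)
    rw [Module.finrank_fin_fun] at this
    rw [← this]
    congr 1
    ext x
    rw [Set.mem_smul_set_iff_inv_smul_mem₀ ht.ne']
    simp only [unitCone, positiveOrthant, Set.mem_inter_iff, Set.mem_ofPred_eq, Set.mem_preimage,
      shape_smul (inv_pos.2 ht), sampleMean_smul, Pi.smul_apply, smul_eq_mul]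
    rw [inv_mul_le_iff₀ ht, mul_one]
    simp only [mul_pos_iff_of_pos_left (inv_pos.2 ht)]

/-- Products of a half-line with a measurable set of shapes form a generating π-system, and on them
the claim is `volume_cone`. -/
theorem map_sampleMean_shape (n : ℕ) [NeZero n] :
    (volume.restrict (positiveOrthant n)).map (fun x => (sampleMean x, shape x)) =
      (radialMeasure n).prod (shapeMeasure n) := by
  have hΦ : Measurable (fun x : Fin n → ℝ => (sampleMean x, shape x)) :=
    measurable_sampleMean.prodMk measurable_shape
  refine (Measure.prod_eq_generateFrom (C := Set.range Set.Iic) (D := {A | MeasurableSet A})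
    (borel_eq_generateFrom_Iic ℝ).symm MeasurableSpace.generateFrom_measurableSet
    isPiSystem_Iic MeasurableSpace.isPiSystem_measurableSet
    ⟨fun k => Set.Iic (k : ℝ), fun k => ⟨_, rfl⟩, fun k => ?_, ?_⟩
    (Measure.toFiniteSpanningSetsIn _) ?_).symm
  · rw [radialMeasure_Iic]
    exact ENNReal.ofReal_lt_top
  · refine Set.eq_univ_of_forall fun x => Set.mem_iUnion.2 ?_
    exact exists_nat_ge x
  · rintro _ ⟨t, rfl⟩ A (hA : MeasurableSet A)
    rw [Measure.map_apply hΦ (measurableSet_Iic.prod hA), radialMeasure_Iic, ← volume_cone hA,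
      Measure.restrict_apply (hΦ (measurableSet_Iic.prod hA))]
    congr 1
    ext x
    simp only [Set.mem_inter_iff, Set.mem_preimage, Set.mem_prod, Set.mem_Iic, Set.mem_ofPred_eq]
    tauto

/-- The joint law of mean and shape of a sample from a density on the positive half-line. -/
theorem pi_apply_mean_shape {n : ℕ} [NeZero n] {f : ℝ → ℝ≥0∞} (hf : Measurable f)
    (hf0 : ∀ x ≤ 0, f x = 0) [IsProbabilityMeasure ((volume : Measure ℝ).withDensity f)]
    {B : Set ℝ} (hB : MeasurableSet B) {A : Set (Fin n → ℝ)} (hA : MeasurableSet A) :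
    Measure.pi (fun _ : Fin n => (volume : Measure ℝ).withDensity f)
        (sampleMean ⁻¹' B ∩ shape ⁻¹' A) =
      ∫⁻ s in B, ∫⁻ w in A, ∏ i, f (s * w i) ∂shapeMeasure n ∂radialMeasure n := by
  have hΦ : Measurable (fun x : Fin n → ℝ => (sampleMean x, shape x)) :=
    measurable_sampleMean.prodMk measurable_shape
  have hO := (isOpen_positiveOrthant n).measurableSet
  have hG : Measurable (fun z : ℝ × (Fin n → ℝ) => ∏ i, f (z.1 * z.2 i)) := by fun_prop
  have hE : MeasurableSet (sampleMean ⁻¹' B ∩ shape ⁻¹' A : Set (Fin n → ℝ)) :=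
    (measurable_sampleMean hB).inter (measurable_shape hA)
  rw [pi_withDensity f hf, withDensity_apply _ hE, ← lintegral_indicator hE,
    ← setLIntegral_eq_of_support_subset (s := positiveOrthant n)]
  · rw [← lintegral_prod _ hG.aemeasurable, Measure.prod_restrict, ← map_sampleMean_shape,
      ← lintegral_indicator (hB.prod hA), lintegral_map (hG.indicator (hB.prod hA)) hΦ]
    refine setLIntegral_congr_fun hO fun x hx => ?_
    have h1 : ∀ i, sampleMean x * shape x i = x i := fun i =>
      congrFun (sampleMean_smul_shape hx) i
    by_cases h : x ∈ sampleMean ⁻¹' B ∩ shape ⁻¹' A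
    · rw [Set.indicator_of_mem h,
        Set.indicator_of_mem (show (sampleMean x, shape x) ∈ B ×ˢ A from h)]
      simp only [h1]
    · rw [Set.indicator_of_notMem h,
        Set.indicator_of_notMem (show (sampleMean x, shape x) ∉ B ×ˢ A from h)]
  · intro x hx i
    by_contra h
    refine hx ?_
    rw [Set.indicator_apply_eq_zero]
    exact fun _ => Finset.prod_eq_zero (Finset.mem_univ i) (hf0 _ (not_lt.1 h))

/-! ### Convexity from local extrema, and the logarithmic correction -/

/-- If the graph rises above a chord, subtracting the slope of the chord equalizes the end values,
and the maximum over the segment is attained inside. -/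
theorem convexOn_of_forall_not_isLocalMax {g : ℝ → ℝ} (hg : ContinuousOn g (Set.Ioi 0))
    (h : ∀ d s : ℝ, 0 < s → ¬ IsLocalMax (fun t => g t - d * t) s) :
    ConvexOn ℝ (Set.Ioi 0) g := by
  refine LinearOrder.convexOn_of_lt (convex_Ioi 0) fun x hx y hy hxy a b ha hb hab => ?_
  by_contra! hlt
  simp only [smul_eq_mul] at hlt
  set z := a * x + b * y with hz
  have hyx : 0 < y - x := sub_pos.2 hxy
  set d := (g y - g x) / (y - x) with hd
  have hdy : d * (y - x) = g y - g x := div_mul_cancel₀ _ hyx.ne'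
  have hzx : z - x = b * (y - x) := by rw [hz, eq_sub_of_add_eq hab]; ring
  have hyz : y - z = a * (y - x) := by rw [hz, eq_sub_of_add_eq hab]; ring
  have hzm : z ∈ Set.Icc x y := ⟨by nlinarith [mul_pos hb hyx], by nlinarith [mul_pos ha hyx]⟩
  have hsub : Set.Icc x y ⊆ Set.Ioi 0 := fun t ht => lt_of_lt_of_le hx ht.1
  have hc : ContinuousOn (fun t => g t - d * t) (Set.Icc x y) :=
    (hg.mono hsub).sub (by fun_prop)
  obtain ⟨t, ht, hmax⟩ := isCompact_Icc.exists_isMaxOn ⟨z, hzm⟩ hc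
  have h1 : g z - d * z ≤ g t - d * t := hmax hzm
  have h2 : g x - d * x < g z - d * z := by
    have : d * z - d * x = b * (g y - g x) := by rw [← mul_sub, hzx, ← hdy]; ring
    have h3 : a * g x = g x - b * g x := by rw [eq_sub_of_add_eq hab]; ring
    linarith
  have h4 : g y - d * y = g x - d * x := by linarith
  refine h d t (hsub ht) (hmax.isLocalMax (Icc_mem_nhds (lt_of_le_of_ne ht.1 ?_)
    (lt_of_le_of_ne ht.2 ?_)))
  · rintro rfl; linarith
  · rintro rfl; linarith

theorem concaveOn_of_forall_not_isLocalMin {g : ℝ → ℝ} (hg : ContinuousOn g (Set.Ioi 0))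
    (h : ∀ d s : ℝ, 0 < s → ¬ IsLocalMin (fun t => g t - d * t) s) :
    ConcaveOn ℝ (Set.Ioi 0) g := by
  rw [← neg_convexOn_iff]
  refine convexOn_of_forall_not_isLocalMax hg.neg fun d s hs hmax => h (-d) s hs ?_
  have : (fun t => g t - -d * t) = fun t => -((-g) t - d * t) := by
    ext t; simp only [Pi.neg_apply]; ring
  rw [this]
  exact hmax.neg

theorem exists_affine_of_convexOn_of_concaveOn {g : ℝ → ℝ} (h1 : ConvexOn ℝ (Set.Ioi 0) g)
    (h2 : ConcaveOn ℝ (Set.Ioi 0) g) : ∃ d e : ℝ, ∀ s, 0 < s → g s = e + d * s := by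
  have key : ∀ x y z : ℝ, 0 < x → x < y → y < z → (g y - g x) * (z - x) = (g z - g x) * (y - x) := by
    intro x y z hx hxy hyz
    have hz : 0 < z := by linarith
    have e1 : 0 < z - x := by linarith
    have ha : 0 ≤ (z - y) / (z - x) := div_nonneg (by linarith) e1.le
    have hb : 0 ≤ (y - x) / (z - x) := div_nonneg (by linarith) e1.le
    have hab : (z - y) / (z - x) + (y - x) / (z - x) = 1 := by field_simp; ring
    have hy : ((z - y) / (z - x)) • x + ((y - x) / (z - x)) • z = y := by
      simp only [smul_eq_mul]; field_simp; ring
    have i1 := h1.2 hx hz ha hb hab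
    have i2 := h2.2 hx hz ha hb hab
    rw [hy] at i1 i2
    have i3 := le_antisymm i1 i2
    simp only [smul_eq_mul] at i3
    rw [i3]; field_simp; ring
  refine ⟨g 2 - g 1, 2 * g 1 - g 2, fun s hs => ?_⟩
  rcases lt_trichotomy s 1 with h | rfl | h
  · linarith [key s 1 2 hs h one_lt_two]
  · ring
  · rcases lt_trichotomy s 2 with h' | rfl | h'
    · linarith [key 1 s 2 one_pos h h']
    · ring
    · linarith [key 1 2 s one_pos one_lt_two h']

theorem continuousOn_sub_mul_log {g : ℝ → ℝ} (hg : ContinuousOn g (Set.Ioi 0)) (c : ℝ) :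
    ContinuousOn (fun s => g s - c * Real.log s) (Set.Ioi 0) :=
  hg.sub (continuousOn_const.mul (Real.continuousOn_log.mono fun _ hs => ne_of_gt hs))

/-- Strict concavity of the logarithm at one triple suffices to show that neither convexity nor
concavity can hold for every coefficient `c`. -/
theorem two_mul_log_two_lt : Real.log 1 + Real.log 3 < 2 * Real.log 2 := by
  rw [← Real.log_mul one_ne_zero three_ne_zero, ← Real.log_rpow two_pos]
  exact Real.log_lt_log (by norm_num) (by norm_num)

/-- If subtracting any multiple of the logarithm, with at most one exception, leaves a convex or a
concave function, then the function is affine up to a multiple of the logarithm. -/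
theorem exists_eq_log_add_affine {g : ℝ → ℝ}
    (h : ∀ c c', c < c' → (ConvexOn ℝ (Set.Ioi 0) (fun s => g s - c * Real.log s) ∨
      ConcaveOn ℝ (Set.Ioi 0) (fun s => g s - c * Real.log s)) ∨
      ConvexOn ℝ (Set.Ioi 0) (fun s => g s - c' * Real.log s) ∨
      ConcaveOn ℝ (Set.Ioi 0) (fun s => g s - c' * Real.log s)) :
    ∃ c d e : ℝ, ∀ s, 0 < s → g s = e + c * Real.log s + d * s := by
  set U := {c : ℝ | ConvexOn ℝ (Set.Ioi 0) (fun s => g s - c * Real.log s)} with hU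
  set V := {c : ℝ | ConcaveOn ℝ (Set.Ioi 0) (fun s => g s - c * Real.log s)} with hV
  have hUc : IsClosed U := by
    have : U = ⋂ (x : ℝ) (_ : x ∈ Set.Ioi (0 : ℝ)) (y : ℝ) (_ : y ∈ Set.Ioi (0 : ℝ)) (a : ℝ) (b : ℝ)
        (_ : 0 ≤ a) (_ : 0 ≤ b) (_ : a + b = 1), {c : ℝ | g (a • x + b • y) -
          c * Real.log (a • x + b • y) ≤
          a • (g x - c * Real.log x) + b • (g y - c * Real.log y)} := by
      ext c
      simp only [Set.mem_iInter]
      exact ⟨fun h x hx y hy a b ha hb hab => h.2 hx hy ha hb hab,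
        fun h => ⟨convex_Ioi 0, fun x hx y hy a b ha hb hab => h x hx y hy a b ha hb hab⟩⟩
    rw [this]
    repeat refine isClosed_iInter fun _ => ?_
    exact isClosed_le (by fun_prop) (by fun_prop)
  have hVc : IsClosed V := by
    have : V = ⋂ (x : ℝ) (_ : x ∈ Set.Ioi (0 : ℝ)) (y : ℝ) (_ : y ∈ Set.Ioi (0 : ℝ)) (a : ℝ) (b : ℝ)
        (_ : 0 ≤ a) (_ : 0 ≤ b) (_ : a + b = 1), {c : ℝ |
          a • (g x - c * Real.log x) + b • (g y - c * Real.log y) ≤ g (a • x + b • y) -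
          c * Real.log (a • x + b • y)} := by
      ext c
      simp only [Set.mem_iInter]
      exact ⟨fun h x hx y hy a b ha hb hab => h.2 hx hy ha hb hab,
        fun h => ⟨convex_Ioi 0, fun x hx y hy a b ha hb hab => h x hx y hy a b ha hb hab⟩⟩
    rw [this]
    repeat refine isClosed_iInter fun _ => ?_
    exact isClosed_le (by fun_prop) (by fun_prop)
  -- The complement of `U ∪ V` is open and has at most one point, so it is empty.
  have hUV : ∀ c, c ∈ U ∨ c ∈ V := by
    intro c
    by_contra hc
    have hev : ∀ᶠ c' in 𝓝[>] c, c' ∈ (U ∪ V)ᶜ :=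
      mem_nhdsWithin_of_mem_nhds ((hUc.union hVc).isOpen_compl.mem_nhds hc)
    obtain ⟨c', hc', hlt⟩ := (hev.and self_mem_nhdsWithin).exists
    exact (h c c' hlt).elim hc hc'
  have hlog := sub_pos.2 two_mul_log_two_lt
  set δ := 2 * Real.log 2 - (Real.log 1 + Real.log 3) with hδ
  set D := g 1 + g 3 - 2 * g 2 with hD
  have h13 : (1 / 2 : ℝ) • (1 : ℝ) + (1 / 2 : ℝ) • (3 : ℝ) = 2 := by norm_num
  have h12 : (0 : ℝ) ≤ 1 / 2 := by norm_num
  have m1 : (1 : ℝ) ∈ Set.Ioi (0 : ℝ) := Set.mem_Ioi.2 one_pos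
  have m3 : (3 : ℝ) ∈ Set.Ioi (0 : ℝ) := Set.mem_Ioi.2 three_pos
  have hUb : ∀ c ∈ U, 0 ≤ D + c * δ := by
    intro c (hc : ConvexOn ℝ (Set.Ioi 0) (fun s => g s - c * Real.log s))
    have := hc.2 m1 m3 h12 h12 (add_halves (1 : ℝ))
    rw [h13] at this
    simp only [smul_eq_mul] at this
    rw [hD, hδ]; linarith
  have hVb : ∀ c ∈ V, D + c * δ ≤ 0 := by
    intro c (hc : ConcaveOn ℝ (Set.Ioi 0) (fun s => g s - c * Real.log s))
    have := hc.2 m1 m3 h12 h12 (add_halves (1 : ℝ))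
    rw [h13] at this
    simp only [smul_eq_mul] at this
    rw [hD, hδ]; linarith
  -- Here `D + c * δ = 1`, which rules out concavity; the next witness gives `-1` and rules out
  -- convexity.
  have hUne : ((-D + 1) / δ) ∈ U := by
    refine (hUV _).resolve_right fun hc => ?_
    have := hVb _ hc
    rw [div_mul_cancel₀ _ hlog.ne'] at this
    linarith
  have hVne : ((-D - 1) / δ) ∈ V := by
    refine (hUV _).resolve_left fun hc => ?_
    have := hUb _ hc
    rw [div_mul_cancel₀ _ hlog.ne'] at this
    linarith
  obtain ⟨c, -, hcU, hcV⟩ := isPreconnected_closed_iff.1 (isPreconnected_univ (α := ℝ)) U V hUc hVc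
    (fun c _ => hUV c) ⟨_, trivial, hUne⟩ ⟨_, trivial, hVne⟩
  obtain ⟨d, e, hde⟩ := exists_affine_of_convexOn_of_concaveOn
    (g := fun s => g s - c * Real.log s) hcU hcV
  exact ⟨c, d, e, fun s hs => by linarith [hde s hs]⟩

/-! ### Integrals over small sets of shapes -/

/-- The box of tuples with all coordinates within one half of one. -/
def halfBox (n : ℕ) : Set (Fin n → ℝ) := Set.Icc (fun _ => 1 / 2) (fun _ => 3 / 2)

theorem halfBox_pos {n : ℕ} {w : Fin n → ℝ} (hw : w ∈ halfBox n) (i : Fin n) : 0 < w i :=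
  lt_of_lt_of_le (by norm_num) (hw.1 i)

theorem halfBox_mem_nhds_one (n : ℕ) : halfBox n ∈ 𝓝 (1 : Fin n → ℝ) := by
  have : halfBox n = Set.univ.pi fun _ => Set.Icc (1 / 2) (3 / 2) := (Set.pi_univ_Icc _ _).symm
  rw [this]
  exact set_pi_mem_nhds Set.finite_univ fun i _ => Icc_mem_nhds (by norm_num) (by norm_num)

theorem continuousOn_prod_dilation {n : ℕ} {f : ℝ → ℝ} (hf : ContinuousOn f (Set.Ioi 0)) :
    ContinuousOn (fun z : ℝ × (Fin n → ℝ) => ∏ i, f (z.1 * z.2 i))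
      (Set.Ioi 0 ×ˢ halfBox n) := by
  refine continuousOn_finsetProd _ fun i _ => hf.comp (by fun_prop) fun z hz => ?_
  exact mul_pos hz.1 (halfBox_pos hz.2 i)

theorem continuousOn_prod_dilation_right {n : ℕ} {f : ℝ → ℝ} (hf : ContinuousOn f (Set.Ioi 0))
    {s : ℝ} (hs : 0 < s) : ContinuousOn (fun w : Fin n → ℝ => ∏ i, f (s * w i)) (halfBox n) :=
  (continuousOn_prod_dilation hf).comp (f := fun w => (s, w)) (by fun_prop) fun _ hw => ⟨hs, hw⟩

section

variable {n : ℕ} {m : Measure (Fin n → ℝ)} [IsFiniteMeasure m]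

theorem integrableOn_of_continuousOn_halfBox {A : Set (Fin n → ℝ)} (hA : A ⊆ halfBox n)
    {g : (Fin n → ℝ) → ℝ} (hg : ContinuousOn g (halfBox n)) : IntegrableOn g A m :=
  (hg.integrableOn_compact isCompact_Icc).mono_set hA

theorem continuousOn_setIntegral_prod_dilation {A : Set (Fin n → ℝ)} (hAm : MeasurableSet A)
    (hA : A ⊆ halfBox n) {f : ℝ → ℝ} (hf : ContinuousOn f (Set.Ioi 0)) :
    ContinuousOn (fun s => ∫ w in A, ∏ i, f (s * w i) ∂m) (Set.Ioi 0) := by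
  intro s₀ hs₀
  have hs₀ : 0 < s₀ := hs₀
  refine ContinuousAt.continuousWithinAt ?_
  have hsub : Set.Icc (s₀ / 2) (2 * s₀) ×ˢ halfBox n ⊆ Set.Ioi 0 ×ˢ halfBox n :=
    Set.prod_mono (fun s hs => lt_of_lt_of_le (by positivity) hs.1) le_rfl
  obtain ⟨M, hM⟩ := (isCompact_Icc.prod (isCompact_Icc : IsCompact (halfBox n))).exists_bound_of_continuousOn
    ((continuousOn_prod_dilation hf).mono hsub)
  have hnhds : Set.Icc (s₀ / 2) (2 * s₀) ∈ 𝓝 s₀ := Icc_mem_nhds (by linarith) (by linarith)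
  refine continuousAt_of_dominated (bound := fun _ => M) ?_ ?_ (integrable_const _) ?_
  · filter_upwards [hnhds] with s hs
    exact (integrableOn_of_continuousOn_halfBox hA (continuousOn_prod_dilation_right hf
      (lt_of_lt_of_le (by positivity) hs.1))).aestronglyMeasurable
  · filter_upwards [hnhds] with s hs
    filter_upwards [ae_restrict_mem hAm] with w hw
    exact hM (s, w) ⟨hs, hA hw⟩
  · filter_upwards [ae_restrict_mem hAm] with w hw
    refine tendsto_finsetProd _ fun i _ => ?_
    have h0 : 0 < s₀ * w i := mul_pos hs₀ (halfBox_pos (hA hw) i)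
    exact (ContinuousAt.comp (g := f) (hf.continuousAt (Ioi_mem_nhds h0)) (by fun_prop))

theorem setIntegral_prod_dilation_pos {A : Set (Fin n → ℝ)} (hAm : MeasurableSet A)
    (hA : A ⊆ halfBox n) (hA0 : m A ≠ 0) {f : ℝ → ℝ} (hf : ContinuousOn f (Set.Ioi 0))
    (hfpos : ∀ x, 0 < x → 0 < f x) {s : ℝ} (hs : 0 < s) :
    0 < ∫ w in A, ∏ i, f (s * w i) ∂m := by
  have hpos : ∀ w ∈ A, 0 < ∏ i, f (s * w i) := fun w hw =>
    Finset.prod_pos fun i _ => hfpos _ (mul_pos hs (halfBox_pos (hA hw) i))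
  rw [setIntegral_pos_iff_support_of_nonneg_ae]
  · refine lt_of_lt_of_le (pos_iff_ne_zero.2 hA0) (measure_mono fun w hw => ⟨?_, hw⟩)
    exact (hpos w hw).ne'
  · filter_upwards [ae_restrict_mem hAm] with w hw using (hpos w hw).le
  · exact integrableOn_of_continuousOn_halfBox hA (continuousOn_prod_dilation_right hf hs)

theorem tendsto_setIntegral_div_measure {A : ℕ → Set (Fin n → ℝ)} (hA : ∀ k, A k ⊆ halfBox n)
    (hAs : Tendsto A atTop (𝓝 1).smallSets) (hA0 : ∀ k, m (A k) ≠ 0)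
    {g : (Fin n → ℝ) → ℝ} (hg : ContinuousOn g (halfBox n)) :
    Tendsto (fun k => (∫ w in A k, g w ∂m) / m.real (A k)) atTop (𝓝 (g 1)) := by
  have hm : ∀ k, 0 < m.real (A k) := fun k => ENNReal.toReal_pos (hA0 k) (measure_ne_top _ _)
  have hbox := halfBox_mem_nhds_one n
  have hg1 : ContinuousAt g 1 := hg.continuousAt hbox
  rw [Metric.tendsto_nhds]
  intro ε hε
  have hev : ∀ᶠ w in 𝓝 (1 : Fin n → ℝ), ‖g w - g 1‖ ≤ ε / 2 := by
    filter_upwards [Metric.tendsto_nhds.1 hg1 (ε / 2) (half_pos hε)] with w hw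
    rw [← dist_eq_norm]; exact hw.le
  filter_upwards [tendsto_smallSets_iff.1 hAs _ hev] with k hk
  have h1 : (∫ w in A k, g w ∂m) - g 1 * m.real (A k) = ∫ w in A k, (g w - g 1) ∂m := by
    rw [integral_sub (integrableOn_of_continuousOn_halfBox (hA k) hg) (integrable_const _)]
    simp [mul_comm]
  have h2 : ‖∫ w in A k, (g w - g 1) ∂m‖ ≤ ε / 2 * m.real (A k) :=
    norm_setIntegral_le_of_norm_le_const (measure_lt_top _ _) fun w hw => hk hw
  rw [dist_eq_norm, div_sub' (hm k).ne', norm_div, mul_comm (m.real (A k)), h1,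
    Real.norm_of_nonneg (hm k).le, div_lt_iff₀ (hm k)]
  nlinarith [hm k]

/-- The sum of the logarithms of the coordinates. -/
noncomputable def logSum (w : Fin n → ℝ) : ℝ := ∑ i, Real.log (w i)

theorem continuousOn_exp_logSum (c : ℝ) :
    ContinuousOn (fun w : Fin n → ℝ => Real.exp (c * logSum w)) (halfBox n) := by
  refine Real.continuous_exp.comp_continuousOn (continuousOn_const.mul ?_)
  refine continuousOn_finsetSum _ fun i _ => ContinuousOn.log (by fun_prop) fun w hw => ?_
  exact (halfBox_pos hw i).ne'

theorem logSum_nonpos {w : Fin n → ℝ} (hw : w ∈ halfBox n) (hsum : ∑ i, (w i - 1) = 0) :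
    logSum w ≤ 0 :=
  hsum ▸ Finset.sum_le_sum fun i _ => Real.log_le_sub_one_of_pos (halfBox_pos hw i)

theorem logSum_neg {w : Fin n → ℝ} (hw : w ∈ halfBox n) (hsum : ∑ i, (w i - 1) = 0)
    (h1 : w ≠ 1) : logSum w < 0 := by
  obtain ⟨j, hj⟩ := Function.ne_iff.1 h1
  exact hsum ▸ Finset.sum_lt_sum (fun i _ => Real.log_le_sub_one_of_pos (halfBox_pos hw i))
    ⟨j, Finset.mem_univ j, Real.log_lt_sub_one_of_pos (halfBox_pos hw j) hj⟩

/-- By `log t ≤ t - 1`, with equality only at `t = 1`, a tuple of mean one other than the constant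
one has negative `logSum`. The integrand thus strictly decreases in `c` on a set of positive
measure. -/
theorem setIntegral_exp_logSum_strictAnti {A : Set (Fin n → ℝ)} (hAm : MeasurableSet A)
    (hA : A ⊆ halfBox n) (hsum : ∀ w ∈ A, ∑ i, (w i - 1) = 0) (hA1 : m (A \ {1}) ≠ 0) :
    StrictAnti fun c : ℝ => ∫ w in A, Real.exp (c * logSum w) ∂m := by
  intro c c' hcc
  have hi := fun c : ℝ => integrableOn_of_continuousOn_halfBox (m := m) hA
    (continuousOn_exp_logSum c)
  rw [← sub_pos, ← integral_sub (hi c) (hi c'), setIntegral_pos_iff_support_of_nonneg_ae]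
  · refine lt_of_lt_of_le (pos_iff_ne_zero.2 hA1) (measure_mono fun w hw => ⟨?_, hw.1⟩)
    refine (sub_pos.2 (Real.exp_lt_exp.2 ?_)).ne'
    exact mul_lt_mul_of_neg_right hcc (logSum_neg (hA hw.1) (hsum w hw.1) hw.2)
  · filter_upwards [ae_restrict_mem hAm] with w hw
    exact sub_nonneg.2 (Real.exp_le_exp.2 (mul_le_mul_of_nonpos_right hcc.le
      (logSum_nonpos (hA hw) (hsum w hw))))
  · exact (hi c).sub (hi c')

/-- The slope `d` disappears because the deviations from one sum to zero. This is why the comparison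
below works for every `d` at once. -/
theorem prod_mul_exp_eq {w : Fin n → ℝ} (hsum : ∑ i, (w i - 1) = 0) (y c d s : ℝ) :
    ∏ i, (y * Real.exp (c * Real.log (w i) + d * s * (w i - 1))) =
      Real.exp (c * logSum w) * y ^ n := by
  rw [Finset.prod_mul_distrib, ← Real.exp_sum, Finset.sum_add_distrib, ← Finset.mul_sum,
    ← Finset.mul_sum, hsum, mul_zero, add_zero]
  simp [logSum, mul_comm]

/-- Near `w = 1`, maximality at `s` bounds each `f (s * w i)` by `f s * exp (c * log (w i) + d * s *
(w i - 1))`; multiply over `i` and integrate. -/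
theorem eventually_setIntegral_le_of_isLocalMax {A : ℕ → Set (Fin n → ℝ)}
    (hAm : ∀ k, MeasurableSet (A k)) (hA : ∀ k, A k ⊆ halfBox n)
    (hsum : ∀ k, ∀ w ∈ A k, ∑ i, (w i - 1) = 0) (hAs : Tendsto A atTop (𝓝 1).smallSets)
    {f : ℝ → ℝ} (hf : ContinuousOn f (Set.Ioi 0)) (hfpos : ∀ x, 0 < x → 0 < f x)
    {c d s : ℝ} (hs : 0 < s)
    (hmax : IsLocalMax (fun t => Real.log (f t) - c * Real.log t - d * t) s) :
    ∀ᶠ k in atTop, ∫ w in A k, ∏ i, f (s * w i) ∂m ≤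
      (∫ w in A k, Real.exp (c * logSum w) ∂m) * f s ^ n := by
  have hev : ∀ᶠ w in 𝓝 (1 : Fin n → ℝ), ∀ i, Real.log (f (s * w i)) - c * Real.log (s * w i)
      - d * (s * w i) ≤ Real.log (f s) - c * Real.log s - d * s := by
    rw [eventually_all]
    intro i
    have ht : Tendsto (fun w : Fin n → ℝ => s * w i) (𝓝 1) (𝓝 s) := by
      have : Continuous (fun w : Fin n → ℝ => s * w i) := by fun_prop
      simpa using this.tendsto 1
    exact ht.eventually hmax
  filter_upwards [tendsto_smallSets_iff.1 hAs _ hev] with k hk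
  rw [← integral_mul_const]
  refine setIntegral_mono_on (integrableOn_of_continuousOn_halfBox (hA k)
    (continuousOn_prod_dilation_right hf hs)) (integrableOn_of_continuousOn_halfBox (hA k)
    ((continuousOn_exp_logSum c).mul continuousOn_const)) (hAm k) fun w hw => ?_
  rw [← prod_mul_exp_eq (hsum k w hw) (f s) c d s]
  refine Finset.prod_le_prod (fun i _ => (hfpos _ (mul_pos hs (halfBox_pos (hA k hw) i))).le)
    fun i _ => ?_
  have hw0 := halfBox_pos (hA k hw) i
  have h1 : _ ≤ _ := hk hw i
  rw [Real.log_mul hs.ne' hw0.ne'] at h1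
  rw [← Real.log_le_log_iff (hfpos _ (mul_pos hs hw0)) (mul_pos (hfpos s hs) (Real.exp_pos _)),
    Real.log_mul (hfpos s hs).ne' (Real.exp_pos _).ne', Real.log_exp]
  linarith

theorem eventually_le_setIntegral_of_isLocalMin {A : ℕ → Set (Fin n → ℝ)}
    (hAm : ∀ k, MeasurableSet (A k)) (hA : ∀ k, A k ⊆ halfBox n)
    (hsum : ∀ k, ∀ w ∈ A k, ∑ i, (w i - 1) = 0) (hAs : Tendsto A atTop (𝓝 1).smallSets)
    {f : ℝ → ℝ} (hf : ContinuousOn f (Set.Ioi 0)) (hfpos : ∀ x, 0 < x → 0 < f x)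
    {c d s : ℝ} (hs : 0 < s)
    (hmin : IsLocalMin (fun t => Real.log (f t) - c * Real.log t - d * t) s) :
    ∀ᶠ k in atTop, (∫ w in A k, Real.exp (c * logSum w) ∂m) * f s ^ n ≤
      ∫ w in A k, ∏ i, f (s * w i) ∂m := by
  have hev : ∀ᶠ w in 𝓝 (1 : Fin n → ℝ), ∀ i, Real.log (f s) - c * Real.log s - d * s ≤
      Real.log (f (s * w i)) - c * Real.log (s * w i) - d * (s * w i) := by
    rw [eventually_all]
    intro i
    have ht : Tendsto (fun w : Fin n → ℝ => s * w i) (𝓝 1) (𝓝 s) := by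
      have : Continuous (fun w : Fin n → ℝ => s * w i) := by fun_prop
      simpa using this.tendsto 1
    exact ht.eventually hmin
  filter_upwards [tendsto_smallSets_iff.1 hAs _ hev] with k hk
  rw [← integral_mul_const]
  refine setIntegral_mono_on (integrableOn_of_continuousOn_halfBox (hA k)
    ((continuousOn_exp_logSum c).mul continuousOn_const))
    (integrableOn_of_continuousOn_halfBox (hA k)
    (continuousOn_prod_dilation_right hf hs)) (hAm k) fun w hw => ?_
  rw [← prod_mul_exp_eq (hsum k w hw) (f s) c d s]
  refine Finset.prod_le_prod (fun i _ => (mul_pos (hfpos s hs) (Real.exp_pos _)).le)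
    fun i _ => ?_
  have hw0 := halfBox_pos (hA k hw) i
  have h1 : _ ≤ _ := hk hw i
  rw [Real.log_mul hs.ne' hw0.ne'] at h1
  rw [← Real.log_le_log_iff (mul_pos (hfpos s hs) (Real.exp_pos _)) (hfpos _ (mul_pos hs hw0)),
    Real.log_mul (hfpos s hs).ne' (Real.exp_pos _).ne', Real.log_exp]
  linarith

/-- A positive continuous function on the half-line whose averages over a shrinking sequence of
sets of shapes are mutually proportional is a gamma density up to normalization. -/
theorem exists_log_eq_of_setIntegral_prod_proportional {A : ℕ → Set (Fin n → ℝ)}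
    (hAm : ∀ k, MeasurableSet (A k)) (hA : ∀ k, A k ⊆ halfBox n)
    (hsum : ∀ k, ∀ w ∈ A k, ∑ i, (w i - 1) = 0) (hAs : Tendsto A atTop (𝓝 1).smallSets)
    (hA1 : ∀ k, m (A k \ {1}) ≠ 0)
    {f : ℝ → ℝ} (hf : ContinuousOn f (Set.Ioi 0)) (hfpos : ∀ x, 0 < x → 0 < f x)
    (hprop : ∀ k l s t, 0 < s → 0 < t →
      (∫ w in A k, ∏ i, f (t * w i) ∂m) * ∫ w in A l, ∏ i, f (s * w i) ∂m =
      (∫ w in A k, ∏ i, f (s * w i) ∂m) * ∫ w in A l, ∏ i, f (t * w i) ∂m) :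
    ∃ c d e : ℝ, ∀ s, 0 < s → Real.log (f s) = e + c * Real.log s + d * s := by
  have hA0 : ∀ k, m (A k) ≠ 0 := fun k h => hA1 k (measure_mono_null Set.sdiff_subset h)
  set J := fun k s => ∫ w in A k, ∏ i, f (s * w i) ∂m with hJ
  set Q := fun k (c : ℝ) => ∫ w in A k, Real.exp (c * logSum w) ∂m with hQ
  have hlim : ∀ s, 0 < s → Tendsto (fun l => J l s / m.real (A l)) atTop (𝓝 (f s ^ n)) := by
    intro s hs
    simpa using tendsto_setIntegral_div_measure hA hAs hA0 (continuousOn_prod_dilation_right hf hs)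
  -- Divide the proportionality between `s` and `1` by the measure of `A l` and let `l` tend to
  -- infinity.
  have hK : ∀ k s, 0 < s → J k s = J k 1 / f 1 ^ n * f s ^ n := by
    intro k s hs
    have h1 := (hlim s hs).const_mul (J k 1)
    have h2 := (hlim 1 one_pos).const_mul (J k s)
    have h3 : (fun l => J k 1 * (J l s / m.real (A l))) =
        fun l => J k s * (J l 1 / m.real (A l)) := by
      ext l
      rw [mul_div_assoc', mul_div_assoc']
      exact congrArg (· / _) (hprop k l s 1 hs one_pos)
    rw [h3] at h1
    have h4 := tendsto_nhds_unique h1 h2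
    have := (pow_pos (hfpos 1 one_pos) n).ne'
    field_simp
    exact h4.symm
  have hψ : ContinuousOn (fun s => Real.log (f s)) (Set.Ioi 0) :=
    hf.log fun s hs => (hfpos s hs).ne'
  have hconv : ∀ c, (∃ᶠ k in atTop, Q k c < J k 1 / f 1 ^ n) →
      ConvexOn ℝ (Set.Ioi 0) (fun s => Real.log (f s) - c * Real.log s) := by
    intro c hc
    refine convexOn_of_forall_not_isLocalMax (continuousOn_sub_mul_log hψ c) fun d s hs hmax => hc ?_
    filter_upwards [eventually_setIntegral_le_of_isLocalMax (m := m) hAm hA hsum hAs hf hfpos hs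
      hmax] with k hk
    rw [not_lt]
    exact le_of_mul_le_mul_right ((hK k s hs).symm.trans_le hk) (pow_pos (hfpos s hs) n)
  have hconc : ∀ c, (∃ᶠ k in atTop, J k 1 / f 1 ^ n < Q k c) →
      ConcaveOn ℝ (Set.Ioi 0) (fun s => Real.log (f s) - c * Real.log s) := by
    intro c hc
    refine concaveOn_of_forall_not_isLocalMin (continuousOn_sub_mul_log hψ c) fun d s hs hmin => hc ?_
    filter_upwards [eventually_le_setIntegral_of_isLocalMin (m := m) hAm hA hsum hAs hf hfpos hs
      hmin] with k hk
    rw [not_lt]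
    exact le_of_mul_le_mul_right (hk.trans_eq (hK k s hs)) (pow_pos (hfpos s hs) n)
  refine exists_eq_log_add_affine fun c c' hcc => ?_
  by_contra! hne
  have e1 := not_frequently.1 (mt (hconv c) hne.1.1)
  have e2 := not_frequently.1 (mt (hconc c) hne.1.2)
  have e3 := not_frequently.1 (mt (hconv c') hne.2.1)
  have e4 := not_frequently.1 (mt (hconc c') hne.2.2)
  -- For such `k`, both `Q k c` and `Q k c'` equal `J k 1 / f 1 ^ n`, against strict monotonicity.
  obtain ⟨k, ⟨⟨h1, h2⟩, h3⟩, h4⟩ := (((e1.and e2).and e3).and e4).exists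
  have hlt : Q k c' < Q k c :=
    setIntegral_exp_logSum_strictAnti (hAm k) (hA k) (hsum k) (hA1 k) hcc
  linarith

end

/-! ### Order statistics and the weighted spread -/

theorem monotone_orderStat {n : ℕ} (x : Fin n → ℝ) : Monotone (orderStat x) :=
  Tuple.monotone_sort x

theorem orderStat_smul {n : ℕ} {c : ℝ} (hc : 0 < c) (x : Fin n → ℝ) :
    orderStat (c • x) = c • orderStat x := by
  refine (Tuple.comp_sort_eq_comp_iff_monotone.2 (?_ : Monotone ((c • x) ∘ Tuple.sort x))).symm
  exact fun i j hij => mul_le_mul_of_nonneg_left (monotone_orderStat x hij) hc.le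

theorem measurable_orderStat {n : ℕ} (i : Fin n) :
    Measurable fun x : Fin n → ℝ => orderStat x i := by
  refine measurable_of_Iic fun t => ?_
  have : (fun x : Fin n → ℝ => orderStat x i) ⁻¹' Set.Iic t = ⋃ σ : Equiv.Perm (Fin n),
      (⋂ (j : Fin n) (k : Fin n) (_ : j ≤ k), {x : Fin n → ℝ | x (σ j) ≤ x (σ k)}) ∩
        {x | x (σ i) ≤ t} := by
    ext x
    simp only [Set.mem_iUnion, Set.mem_inter_iff, Set.mem_iInter]
    constructor
    · exact fun h => ⟨Tuple.sort x, fun j k hjk => monotone_orderStat x hjk, h⟩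
    · rintro ⟨σ, hσ, h⟩
      have hm : Monotone (x ∘ σ) := fun j k hjk => hσ j k hjk
      have h1 : x (σ i) = orderStat x i :=
        congrFun (Tuple.comp_sort_eq_comp_iff_monotone.2 hm) i
      exact Set.mem_Iic.2 (h1.symm.trans_le h)
  rw [this]
  refine MeasurableSet.iUnion fun σ => MeasurableSet.inter ?_ ?_
  · refine MeasurableSet.iInter fun j => MeasurableSet.iInter fun k => MeasurableSet.iInter fun _ => ?_
    exact measurableSet_le (measurable_pi_apply _) (measurable_pi_apply _)
  · exact measurableSet_le (measurable_pi_apply _) measurable_const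

theorem measurable_weightedSpread {n : ℕ} (a : Fin n → Fin n → ℝ) (p : ℝ) :
    Measurable (weightedSpread a p) := by
  unfold weightedSpread
  refine Finset.measurable_sum _ fun i _ => Finset.measurable_sum _ fun j _ => ?_
  have h := (measurable_orderStat i).sub (measurable_orderStat j)
  exact (h.abs.pow_const p).const_mul _

section

variable {n : ℕ} {a : Fin n → Fin n → ℝ} {p : ℝ}

theorem weightedSpread_nonneg (ha : ∀ i j, 0 ≤ a i j) (x : Fin n → ℝ) :
    0 ≤ weightedSpread a p x :=
  Finset.sum_nonneg fun i _ => Finset.sum_nonneg fun j _ => mul_nonneg (ha i j) (by positivity)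

theorem weightedSpread_smul {c : ℝ} (hc : 0 < c) (x : Fin n → ℝ) :
    weightedSpread a p (c • x) = c ^ p * weightedSpread a p x := by
  simp only [weightedSpread, orderStat_smul hc, Finset.mul_sum, Pi.smul_apply, smul_eq_mul,
    ← mul_sub, abs_mul, abs_of_pos hc, Real.mul_rpow hc.le (abs_nonneg _)]
  exact Finset.sum_congr rfl fun i _ => Finset.sum_congr rfl fun j _ => by ring

theorem weightedSpread_rpow_smul (hp : 0 < p) (ha : ∀ i j, 0 ≤ a i j) {c : ℝ} (hc : 0 < c)
    (x : Fin n → ℝ) :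
    weightedSpread a p (c • x) ^ (1 / p) = c * weightedSpread a p x ^ (1 / p) := by
  rw [weightedSpread_smul hc, Real.mul_rpow (by positivity) (weightedSpread_nonneg ha x),
    ← Real.rpow_mul hc.le, mul_one_div_cancel hp.ne', Real.rpow_one]

theorem exists_orderStat_eq (x : Fin n → ℝ) (i : Fin n) : ∃ j, orderStat x j = x i :=
  ⟨(Tuple.sort x).symm i, by simp [orderStat]⟩

/-- Continuity of the order statistics is not needed: whatever the sorting permutation, each entry
of `w` is within `‖w - 1‖` of one. -/
theorem tendsto_weightedSpread_one (hp : 0 < p) :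
    Tendsto (fun w => weightedSpread a p w ^ (1 / p)) (𝓝 (1 : Fin n → ℝ)) (𝓝 0) := by
  have hterm : ∀ i j : Fin n, Tendsto (fun w : Fin n → ℝ => |orderStat w i - orderStat w j|)
      (𝓝 1) (𝓝 0) := by
    intro i j
    have hnorm : Tendsto (fun w : Fin n → ℝ => 2 * ‖w - 1‖) (𝓝 1) (𝓝 0) := by
      have : Continuous (fun w : Fin n → ℝ => 2 * ‖w - 1‖) := by fun_prop
      simpa using this.tendsto 1
    refine squeeze_zero (fun _ => abs_nonneg _) (fun w => ?_) hnorm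
    have h1 : ∀ k, |w k - 1| ≤ ‖w - 1‖ := fun k => norm_le_pi_norm (w - 1) k
    have h2 := abs_sub_le (orderStat w i) 1 (orderStat w j)
    rw [abs_sub_comm 1] at h2
    have h3 := h1 (Tuple.sort w i)
    have h4 := h1 (Tuple.sort w j)
    simp only [orderStat, Function.comp_apply] at h2 ⊢
    linarith
  have hsum : Tendsto (weightedSpread a p) (𝓝 (1 : Fin n → ℝ))
      (𝓝 (∑ i, ∑ j, a i j * (0 : ℝ) ^ p)) :=
    tendsto_finsetSum _ fun i _ => tendsto_finsetSum _ fun j _ =>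
      ((hterm i j).rpow_const (Or.inr hp.le)).const_mul _
  simp only [Real.zero_rpow hp.ne', mul_zero, Finset.sum_const_zero] at hsum
  have := hsum.rpow_const (p := 1 / p) (Or.inr (by positivity))
  rwa [Real.zero_rpow (by positivity)] at this

/-- Each of the two extreme terms is bounded separately by the whole sum. The resulting factor 2
also covers `n = 1`, where they are the same term. -/
theorem mul_range_rpow_le_weightedSpread (hn : 0 < n) (ha : ∀ i j, 0 ≤ a i j) (x : Fin n → ℝ) :
    (a ⟨0, hn⟩ ⟨n - 1, by omega⟩ + a ⟨n - 1, by omega⟩ ⟨0, hn⟩) *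
      |orderStat x ⟨n - 1, by omega⟩ - orderStat x ⟨0, hn⟩| ^ p ≤ 2 * weightedSpread a p x := by
  have h : ∀ i j, a i j * |orderStat x i - orderStat x j| ^ p ≤ weightedSpread a p x := by
    intro i j
    refine le_trans ?_ (Finset.single_le_sum (f := fun i => ∑ j, a i j *
      |orderStat x i - orderStat x j| ^ p) (fun i _ => Finset.sum_nonneg fun j _ =>
        mul_nonneg (ha i j) (by positivity)) (Finset.mem_univ i))
    exact Finset.single_le_sum (f := fun j => a i j *
      |orderStat x i - orderStat x j| ^ p) (fun j _ =>
        mul_nonneg (ha i j) (by positivity)) (Finset.mem_univ j)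
  have h1 := h ⟨0, hn⟩ ⟨n - 1, by omega⟩
  have h2 := h ⟨n - 1, by omega⟩ ⟨0, hn⟩
  rw [abs_sub_comm] at h1
  linarith

/-- The mean, here one, lies between the smallest and the largest entry, as does each coordinate. -/
theorem abs_sub_le_range (hn : 0 < n) (x : Fin n → ℝ) (hx : sampleMean x = 1) (i : Fin n) :
    |x i - 1| ≤ |orderStat x ⟨n - 1, by omega⟩ - orderStat x ⟨0, hn⟩| := by
  have : NeZero n := ⟨hn.ne'⟩
  have hlo : ∀ j, orderStat x ⟨0, hn⟩ ≤ x j := by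
    intro j
    obtain ⟨k, hk⟩ := exists_orderStat_eq x j
    exact hk ▸ monotone_orderStat x (Fin.mk_le_of_le_val (Nat.zero_le _))
  have hhi : ∀ j, x j ≤ orderStat x ⟨n - 1, by omega⟩ := by
    intro j
    obtain ⟨k, hk⟩ := exists_orderStat_eq x j
    exact hk ▸ monotone_orderStat x (Fin.le_def.2 (by have := k.2; simp only; omega))
  have hsum := sampleMean_eq_one_iff.1 hx
  have h1 : ∃ j, x j - 1 ≤ 0 := by
    by_contra! h
    exact absurd hsum (Finset.sum_pos (fun j _ => h j) ⟨i, Finset.mem_univ i⟩).ne'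
  have h2 : ∃ j, 0 ≤ x j - 1 := by
    by_contra! h
    exact absurd hsum (Finset.sum_neg (fun j _ => h j) ⟨i, Finset.mem_univ i⟩).ne
  obtain ⟨j, hj⟩ := h1
  obtain ⟨k, hk⟩ := h2
  refine le_trans (abs_le.2 ⟨?_, ?_⟩) (le_abs_self _)
  · linarith [hlo i, hhi k]
  · linarith [hlo j, hhi i]

theorem exists_weightedSpread_le_imp_mem (hn : 0 < n) (hp : 0 < p) (ha : ∀ i j, 0 ≤ a i j)
    (ha1n : 0 < a ⟨0, hn⟩ ⟨n - 1, by omega⟩ + a ⟨n - 1, by omega⟩ ⟨0, hn⟩)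
    {U : Set (Fin n → ℝ)} (hU : U ∈ 𝓝 1) :
    ∃ ε > 0, ∀ w, sampleMean w = 1 → weightedSpread a p w ^ (1 / p) ≤ ε → w ∈ U := by
  obtain ⟨η, hη, hball⟩ := Metric.nhds_basis_closedBall.mem_iff.1 hU
  set b := a ⟨0, hn⟩ ⟨n - 1, by omega⟩ + a ⟨n - 1, by omega⟩ ⟨0, hn⟩ with hb
  have hε : 0 < b / 2 * η ^ p := by positivity
  refine ⟨(b / 2 * η ^ p) ^ (1 / p), by positivity, fun w hw hT => hball ?_⟩
  rw [Real.rpow_le_rpow_iff (weightedSpread_nonneg ha w) hε.le (by positivity)] at hT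
  have h1 := mul_range_rpow_le_weightedSpread (p := p) hn ha w
  rw [← hb] at h1
  have h2 : |orderStat w ⟨n - 1, by omega⟩ - orderStat w ⟨0, hn⟩| ^ p ≤ η ^ p :=
    le_of_mul_le_mul_left (by linarith) ha1n
  rw [Real.rpow_le_rpow_iff (abs_nonneg _) hη.le hp] at h2
  rw [mem_closedBall_iff_norm, pi_norm_le_iff_of_nonneg hη.le]
  exact fun i => (abs_sub_le_range hn w hw i).trans h2

end

/-! ### From independence to the form of the density -/

theorem ae_restrict_of_ae_radialMeasure {n : ℕ} [NeZero n] {q : ℝ → Prop}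
    (h : ∀ᵐ s ∂radialMeasure n, q s) : ∀ᵐ s ∂(volume.restrict (Set.Ioi (0 : ℝ))), q s := by
  rw [radialMeasure, ae_withDensity_iff (by fun_prop)] at h
  filter_upwards [h, ae_restrict_mem measurableSet_Ioi] with s hs hs0
  refine hs (ne_of_gt (ENNReal.ofReal_pos.2 ?_))
  have h1 : (0 : ℝ) < s := hs0
  have h2 : (0 : ℝ) < n := Nat.cast_pos.2 (NeZero.pos n)
  positivity

theorem ae_radialMeasure_pos {n : ℕ} : ∀ᵐ s ∂radialMeasure n, 0 < s :=
  (withDensity_absolutelyContinuous _ _).ae_le (ae_restrict_mem measurableSet_Ioi)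

/-- The sets of shapes of mean one close to the constant shape have positive measure, even without
the constant shape. -/
theorem shapeMeasure_diff_one_ne_zero {n : ℕ} (hn : 2 ≤ n) {V : Set (Fin n → ℝ)}
    (hVm : MeasurableSet V) (hV : V ∈ 𝓝 1) :
    shapeMeasure n ((V ∩ {w | sampleMean w = 1}) \ {1}) ≠ 0 := by
  have : NeZero n := ⟨by omega⟩
  have hn0 : (n : ℝ) ≠ 0 := NeZero.ne _
  have hcont : Continuous (sampleMean : (Fin n → ℝ) → ℝ) := by unfold sampleMean; fun_prop
  have hSm : MeasurableSet {w : Fin n → ℝ | sampleMean w = 1} :=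
    measurableSet_eq_fun measurable_sampleMean measurable_const
  rw [shapeMeasure_apply ((hVm.inter hSm).diff (measurableSet_singleton 1))]
  -- This tuple is interior to the unit cone and has shape one. Moving one coordinate slightly keeps
  -- the open conditions and makes two entries differ, so a whole neighbourhood of the new point
  -- avoids shape one.
  set y : Fin n → ℝ := fun _ => 1 / 2 with hy
  have hy0 : y ∈ positiveOrthant n := fun _ => by simp [hy]
  have hmy : sampleMean y = 1 / 2 := by simp [hy, sampleMean]; field_simp
  have hsy : shape y = 1 := by ext i; rw [shape, hmy]; simp [hy]
  have hshape : ContinuousAt shape y :=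
    (hcont.continuousAt.inv₀ (by rw [hmy]; norm_num)).smul continuousAt_id
  have h1 : ∀ᶠ x in 𝓝 y, x ∈ unitCone n ∧ shape x ∈ V := by
    refine ((((isOpen_positiveOrthant n).eventually_mem hy0).and ?_).and ?_).mono
      fun x hx => ⟨⟨hx.1.1, hx.1.2⟩, hx.2⟩
    · exact (hcont.tendsto y).eventually (Iic_mem_nhds (by rw [hmy]; norm_num))
    · exact hshape (by rwa [hsy])
  let i0 : Fin n := ⟨0, by omega⟩
  let i1 : Fin n := ⟨1, by omega⟩
  have hi : i1 ≠ i0 := by simp [i0, i1, Fin.ext_iff]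
  have hcurve : Tendsto (fun t : ℝ => Function.update y i0 (1 / 2 + t)) (𝓝[≠] 0) (𝓝 y) := by
    have hc : Continuous (fun t : ℝ => Function.update y i0 (1 / 2 + t)) := by fun_prop
    have := hc.tendsto 0
    rw [add_zero, show (1 / 2 : ℝ) = y i0 from rfl, Function.update_eq_self] at this
    exact this.mono_left nhdsWithin_le_nhds
  obtain ⟨t, ht, ht0⟩ :=
    ((hcurve.eventually h1.eventually_nhds).and self_mem_nhdsWithin).exists
  have hne : ∀ᶠ x in 𝓝 (Function.update y i0 (1 / 2 + t)), x i0 ≠ x i1 := by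
    refine (isOpen_ne_fun (continuous_apply i0) (continuous_apply i1)).mem_nhds ?_
    simpa [hi, hy, -one_div] using ht0
  refine (Measure.measure_pos_of_mem_nhds volume (x := Function.update y i0 (1 / 2 + t)) ?_).ne'
  filter_upwards [ht, hne] with x hx hx01
  refine ⟨hx.1, ⟨hx.2, sampleMean_shape hx.1.1⟩, fun hx1 => hx01 ?_⟩
  have hx1 : shape x = 1 := hx1
  rw [← sampleMean_smul_shape hx.1.1, hx1]
  rfl

section

variable {n : ℕ} {f : ℝ → ℝ}

theorem lintegral_ofReal_prod_dilation {m : Measure (Fin n → ℝ)} [IsFiniteMeasure m]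
    {A : Set (Fin n → ℝ)} (hAm : MeasurableSet A) (hA : A ⊆ halfBox n)
    (hf : ContinuousOn f (Set.Ioi 0)) (hfpos : ∀ x, 0 < x → 0 < f x) {s : ℝ} (hs : 0 < s) :
    ∫⁻ w in A, ∏ i, ENNReal.ofReal (f (s * w i)) ∂m =
      ENNReal.ofReal (∫ w in A, ∏ i, f (s * w i) ∂m) := by
  have hpos : ∀ w ∈ A, ∀ i, 0 < f (s * w i) := fun w hw i =>
    hfpos _ (mul_pos hs (halfBox_pos (hA hw) i))
  rw [ofReal_integral_eq_lintegral_ofReal]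
  · exact setLIntegral_congr_fun hAm fun w hw =>
      (ENNReal.ofReal_prod_of_nonneg fun i _ => (hpos w hw i).le).symm
  · exact integrableOn_of_continuousOn_halfBox hA (continuousOn_prod_dilation_right hf hs)
  · filter_upwards [ae_restrict_mem hAm] with w hw using
      Finset.prod_nonneg fun i _ => (hpos w hw i).le

/-- A statistic that is homogeneous of degree one and controls the distance of a tuple of mean one
to the constant tuple. -/
structure IsSpread (T : (Fin n → ℝ) → ℝ) : Prop where
  measurable : Measurable T
  smul : ∀ c : ℝ, 0 < c → ∀ x, T (c • x) = c * T x
  tendsto : Tendsto T (𝓝 1) (𝓝 0)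
  exists_le_imp_mem : ∀ U ∈ 𝓝 (1 : Fin n → ℝ), ∃ ε > 0, ∀ w, sampleMean w = 1 → T w ≤ ε → w ∈ U

/-- Independence on the events `T (shape x) ≤ r k` yields the proportional integrals required by
`exists_log_eq_of_setIntegral_prod_proportional`. -/
theorem IsSpread.log_density_eq [NeZero n] (hn : 2 ≤ n) {T : (Fin n → ℝ) → ℝ} (hT : IsSpread T)
    (hfm : Measurable f) (hf0 : ∀ x ≤ 0, f x = 0)
    (hf : ContinuousOn f (Set.Ioi 0)) (hfpos : ∀ x, 0 < x → 0 < f x)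
    [IsProbabilityMeasure ((volume : Measure ℝ).withDensity fun x => ENNReal.ofReal (f x))]
    (hindep : IndepFun sampleMean (fun x => T (shape x))
      (Measure.pi fun _ : Fin n => (volume : Measure ℝ).withDensity
        fun x => ENNReal.ofReal (f x))) :
    ∃ c d e : ℝ, ∀ s, 0 < s → Real.log (f s) = e + c * Real.log s + d * s := by
  set φ : ℝ → ℝ≥0∞ := fun x => ENNReal.ofReal (f x) with hφ
  have hφm : Measurable φ := hfm.ennreal_ofReal
  have hφ0 : ∀ x ≤ 0, φ x = 0 := fun x hx => by simp [hφ, hf0 x hx]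
  set μ := Measure.pi fun _ : Fin n => (volume : Measure ℝ).withDensity φ with hμ
  set m := shapeMeasure n with hm
  have hbox := halfBox_mem_nhds_one n
  obtain ⟨ε, hε, hεbox⟩ := hT.exists_le_imp_mem _ hbox
  set r : ℕ → ℝ := fun k => ε / (k + 1) with hr
  have hr0 : ∀ k, 0 < r k := fun k => by positivity
  have hrε : ∀ k, r k ≤ ε := fun k => div_le_self hε.le (by linarith [(Nat.cast_nonneg k : (0:ℝ) ≤ k)])
  have hrlim : Tendsto r atTop (𝓝 0) := by
    simpa [hr, div_eq_mul_inv] using tendsto_one_div_add_atTop_nhds_zero_nat.const_mul ε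
  set V : ℕ → Set (Fin n → ℝ) := fun k => {w | T w ≤ r k} with hV
  have hVm : ∀ k, MeasurableSet (V k) := fun k => measurableSet_le hT.measurable measurable_const
  -- Independence speaks of `V k`; mean one, needed for the local comparison, holds almost
  -- everywhere under the shape measure.
  set A : ℕ → Set (Fin n → ℝ) := fun k => V k ∩ {w | sampleMean w = 1} with hA'
  have hAm : ∀ k, MeasurableSet (A k) := fun k => (hVm k).inter
    (measurableSet_eq_fun measurable_sampleMean measurable_const)
  have hA : ∀ k, A k ⊆ halfBox n := fun k w hw => hεbox w hw.2 (le_trans hw.1 (hrε k))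
  have hA1 : ∀ k, m (A k \ {1}) ≠ 0 := fun k =>
    shapeMeasure_diff_one_ne_zero hn (hVm k) (hT.tendsto (Iic_mem_nhds (hr0 k)))
  have hA0 : ∀ k, m (A k) ≠ 0 := fun k h => hA1 k (measure_mono_null Set.sdiff_subset h)
  have hAs : Tendsto A atTop (𝓝 1).smallSets := by
    rw [tendsto_smallSets_iff]
    intro U hU
    obtain ⟨δ, hδ, hδU⟩ := hT.exists_le_imp_mem U hU
    filter_upwards [hrlim (Iic_mem_nhds hδ)] with k hk w hw
    exact hδU w hw.2 (le_trans hw.1 hk)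
  set Jhat : ℕ → ℝ → ℝ≥0∞ := fun k s => ∫⁻ w in A k, ∏ i, φ (s * w i) ∂m with hJhat
  set J : ℕ → ℝ → ℝ := fun k s => ∫ w in A k, ∏ i, f (s * w i) ∂m with hJ
  have hJJ : ∀ k s, 0 < s → Jhat k s = ENNReal.ofReal (J k s) := fun k s hs =>
    lintegral_ofReal_prod_dilation (hAm k) (hA k) hf hfpos hs
  have hJpos : ∀ k s, 0 < s → 0 < J k s := fun k s hs =>
    setIntegral_prod_dilation_pos (hAm k) (hA k) (hA0 k) hf hfpos hs
  have hJm : ∀ k, Measurable (Jhat k) := fun k => by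
    have : Measurable (fun z : ℝ × (Fin n → ℝ) => ∏ i, φ (z.1 * z.2 i)) := by fun_prop
    exact this.lintegral_prod_right'
  set q : ℕ → ℝ≥0∞ := fun k => μ (shape ⁻¹' V k) with hq
  have hqtop : ∀ k, q k ≠ ∞ := fun k => measure_ne_top _ _
  have hVA : ∀ k, m.restrict (V k) = m.restrict (A k) := fun k => by
    refine Measure.restrict_congr_set ?_
    filter_upwards [ae_shapeMeasure n] with w hw
    exact propext ⟨fun h => ⟨h, hw.2⟩, fun h => h.1⟩
  have hjoint : ∀ k B, MeasurableSet B →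
      ∫⁻ s in B, Jhat k s ∂radialMeasure n = μ (sampleMean ⁻¹' B) * q k := by
    intro k B hB
    have h1 := pi_apply_mean_shape (n := n) hφm hφ0 hB (hVm k)
    rw [hVA k] at h1
    rw [← h1]
    exact hindep.measure_inter_preimage_eq_mul B (Set.Iic (r k)) hB measurableSet_Iic
  have hae : ∀ k l, ∀ᵐ s ∂radialMeasure n, q l * Jhat k s = q k * Jhat l s := by
    intro k l
    refine ae_eq_of_forall_setLIntegral_eq_of_sigmaFinite ((hJm k).const_mul _)
      ((hJm l).const_mul _) fun B hB _ => ?_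
    rw [lintegral_const_mul _ (hJm k), lintegral_const_mul _ (hJm l), hjoint k B hB, hjoint l B hB]
    ring
  -- Both sides are continuous in `s`, so the almost everywhere identity holds everywhere.
  have heq : ∀ k l s, 0 < s → (q l).toReal * J k s = (q k).toReal * J l s := by
    intro k l s hs
    refine Measure.eqOn_open_of_ae_eq (μ := volume) (U := Set.Ioi 0)
      (f := fun s => (q l).toReal * J k s) (g := fun s => (q k).toReal * J l s) ?_ isOpen_Ioi
      (continuousOn_const.mul (continuousOn_setIntegral_prod_dilation (hAm k) (hA k) hf))
      (continuousOn_const.mul (continuousOn_setIntegral_prod_dilation (hAm l) (hA l) hf)) hs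
    filter_upwards [ae_restrict_of_ae_radialMeasure (hae k l), ae_restrict_mem measurableSet_Ioi]
      with t ht ht0
    have := congrArg ENNReal.toReal ht
    rwa [ENNReal.toReal_mul, ENNReal.toReal_mul, hJJ k t ht0, hJJ l t ht0,
      ENNReal.toReal_ofReal (hJpos k t ht0).le, ENNReal.toReal_ofReal (hJpos l t ht0).le] at this
  have hqpos : ∀ k, (q k).toReal ≠ 0 := by
    intro k hk
    have hk0 : q k = 0 := (ENNReal.toReal_eq_zero_iff _).1 hk |>.resolve_right (hqtop k)
    have h1 := hjoint k Set.univ MeasurableSet.univ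
    rw [hk0, mul_zero, Measure.restrict_univ, lintegral_eq_zero_iff (hJm k)] at h1
    have h2 := ae_restrict_of_ae_radialMeasure h1
    have : (ae ((volume : Measure ℝ).restrict (Set.Ioi 0))).NeBot := by
      rw [ae_neBot]; simp
    obtain ⟨s, hs, hs0⟩ := (h2.and (ae_restrict_mem measurableSet_Ioi)).exists
    rw [hJJ k s hs0] at hs
    exact (ENNReal.ofReal_pos.2 (hJpos k s hs0)).ne' hs
  refine exists_log_eq_of_setIntegral_prod_proportional hAm hA
    (fun k w hw => sampleMean_eq_one_iff.1 hw.2) hAs hA1 hf hfpos fun k l s t hs ht => ?_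
  refine mul_left_cancel₀ (hqpos k) ?_
  have e1 := heq k l s hs
  have e2 := heq k l t ht
  calc (q k).toReal * (J k t * J l s) = J k t * ((q k).toReal * J l s) := by ring
    _ = J k s * ((q l).toReal * J k t) := by rw [← e1]; ring
    _ = (q k).toReal * (J k s * J l t) := by rw [e2]; ring

end

/-! ### Independence for gamma samples -/

/-- The factors need no normalization: taking whole spaces gives `ρ univ * τ univ = 1`, which turns
`ρ` and `τ` into the marginals. -/
theorem IndepFun.of_measure_inter_eq_mul {Ω α β : Type*} [MeasurableSpace Ω] [MeasurableSpace α]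
    [MeasurableSpace β] {μ : Measure Ω} [IsProbabilityMeasure μ] {Y : Ω → α} {Z : Ω → β}
    {ρ : Set α → ℝ≥0∞} {τ : Set β → ℝ≥0∞}
    (h : ∀ B A, MeasurableSet B → MeasurableSet A → μ (Y ⁻¹' B ∩ Z ⁻¹' A) = ρ B * τ A) :
    IndepFun Y Z μ := by
  rw [indepFun_iff_measure_inter_preimage_eq_mul]
  intro B A hB hA
  have h1 := h Set.univ Set.univ .univ .univ
  have h2 := h B Set.univ hB .univ
  have h3 := h Set.univ A .univ hA
  simp only [Set.preimage_univ, Set.inter_univ, Set.univ_inter, measure_univ] at h1 h2 h3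
  rw [h B A hB hA, h2, h3, show ρ B * τ Set.univ * (ρ Set.univ * τ A) =
    ρ Set.univ * τ Set.univ * (ρ B * τ A) by ring, ← h1, one_mul]

theorem indepFun_comp_iff_map {Ω α β γ : Type*} [MeasurableSpace Ω] [MeasurableSpace α]
    [MeasurableSpace β] [MeasurableSpace γ] {P : Measure Ω} {V : Ω → α} (hV : AEMeasurable V P)
    {Y : α → β} {Z : α → γ} (hY : Measurable Y) (hZ : Measurable Z) :
    IndepFun (fun ω => Y (V ω)) (fun ω => Z (V ω)) P ↔ IndepFun Y Z (P.map V) := by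
  simp only [indepFun_iff_measure_inter_preimage_eq_mul]
  refine forall_congr' fun B => forall_congr' fun A => forall_congr' fun hB => forall_congr'
    fun hA => ?_
  rw [Measure.map_apply_of_aemeasurable hV ((hY hB).inter (hZ hA)),
    Measure.map_apply_of_aemeasurable hV (hY hB), Measure.map_apply_of_aemeasurable hV (hZ hA)]
  rfl

theorem ae_pi_mem_positiveOrthant {n : ℕ} {F : Measure ℝ} [IsProbabilityMeasure F]
    (hF : ∀ᵐ x ∂F, 0 < x) : ∀ᵐ x ∂Measure.pi fun _ : Fin n => F, x ∈ positiveOrthant n :=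
  ae_all_iff.2 fun i => (measurePreserving_eval (fun _ : Fin n => F) i).quasiMeasurePreserving.ae hF

/-- For a positive sample, the ratio of a homogeneous statistic to the mean depends only on the
shape. -/
theorem indepFun_sampleMean_div_iff {n : ℕ} [NeZero n] {T : (Fin n → ℝ) → ℝ}
    (hT : ∀ c : ℝ, 0 < c → ∀ x, T (c • x) = c * T x) {F : Measure ℝ} [IsProbabilityMeasure F]
    (hF : ∀ᵐ x ∂F, 0 < x) :
    IndepFun sampleMean (fun x => T x / sampleMean x) (Measure.pi fun _ : Fin n => F) ↔
      IndepFun sampleMean (fun x => T (shape x)) (Measure.pi fun _ : Fin n => F) := by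
  have h : (fun x => T x / sampleMean x) =ᵐ[Measure.pi fun _ : Fin n => F]
      fun x => T (shape x) := by
    filter_upwards [ae_pi_mem_positiveOrthant hF] with x hx
    rw [shape, hT _ (inv_pos.2 (sampleMean_pos hx)), div_eq_inv_mul]
  exact ⟨fun hi => hi.congr .rfl h, fun hi => hi.congr .rfl h.symm⟩

/-- The gamma distribution as the law of a density vanishing off the open half-line. -/
theorem gammaMeasure_eq_withDensity_indicator (a r : ℝ) :
    gammaMeasure a r = volume.withDensity ((Set.Ioi 0).indicator (gammaPDF a r)) := by
  refine withDensity_congr_ae ?_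
  have h0 : ∀ᵐ x : ℝ, x ≠ 0 := by simp [ae_iff]
  filter_upwards [h0] with x hx
  rcases lt_or_gt_of_ne hx with h | h
  · rw [gammaPDF_of_neg h, Set.indicator_of_notMem (by simpa using h.le)]
  · rw [Set.indicator_of_mem (by simpa using h)]

/-- On mean one the exponentials multiply to a function of `s` only, and the powers separate. -/
theorem prod_gammaPDF_dilation {n : ℕ} [NeZero n] {a r : ℝ} (ha : 0 < a) (hr : 0 < r) {s : ℝ}
    (hs : 0 < s) {w : Fin n → ℝ} (hw : w ∈ positiveOrthant n) (hw1 : sampleMean w = 1) :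
    ∏ i, (Set.Ioi 0).indicator (gammaPDF a r) (s * w i) =
      ENNReal.ofReal ((r ^ a / Real.Gamma a * s ^ (a - 1) * Real.exp (-(r * s))) ^ n) *
        ENNReal.ofReal (∏ i, w i ^ (a - 1)) := by
  have hpos : ∀ i, 0 < s * w i := fun i => mul_pos hs (hw i)
  have hsum : ∑ i, (w i - 1) = 0 := sampleMean_eq_one_iff.1 hw1
  have hG := Real.Gamma_pos_of_pos ha
  have h1 : ∀ i, (Set.Ioi 0).indicator (gammaPDF a r) (s * w i) =
      ENNReal.ofReal ((r ^ a / Real.Gamma a * s ^ (a - 1) * Real.exp (-(r * s))) *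
        (w i ^ (a - 1) * Real.exp (-(r * s) * (w i - 1)))) := by
    intro i
    rw [Set.indicator_of_mem (by simpa using hpos i), gammaPDF_of_nonneg (hpos i).le,
      Real.mul_rpow hs.le (hw i).le,
      show -(r * (s * w i)) = -(r * s) + -(r * s) * (w i - 1) by ring, Real.exp_add]
    congr 1
    ring
  have h2 : ∏ i, Real.exp (-(r * s) * (w i - 1)) = 1 := by
    rw [← Real.exp_sum, ← Finset.mul_sum, hsum, mul_zero, Real.exp_zero]
  have hw0 : ∀ i, 0 < w i := hw
  rw [Finset.prod_congr rfl fun i _ => h1 i, ← ENNReal.ofReal_prod_of_nonneg,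
    ← ENNReal.ofReal_mul (by positivity), Finset.prod_mul_distrib, Finset.prod_const,
    Finset.prod_mul_distrib, h2, mul_one, Finset.card_univ, Fintype.card_fin]
  · intro i _
    have := hw0 i
    positivity

theorem indepFun_sampleMean_shape_gamma {n : ℕ} [NeZero n] {a r : ℝ} (ha : 0 < a) (hr : 0 < r) :
    IndepFun sampleMean shape (Measure.pi fun _ : Fin n => gammaMeasure a r) := by
  have hp := isProbabilityMeasure_gammaMeasure ha hr
  rw [gammaMeasure_eq_withDensity_indicator] at hp ⊢
  have hm : Measurable ((Set.Ioi 0).indicator (gammaPDF a r)) :=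
    (measurable_gammaPDFReal a r).ennreal_ofReal.indicator measurableSet_Ioi
  set u : ℝ → ℝ≥0∞ := fun s =>
    ENNReal.ofReal ((r ^ a / Real.Gamma a * s ^ (a - 1) * Real.exp (-(r * s))) ^ n) with hu
  set v : (Fin n → ℝ) → ℝ≥0∞ := fun w => ENNReal.ofReal (∏ i, w i ^ (a - 1)) with hv
  have hum : Measurable u := by fun_prop
  have hvm : Measurable v := by fun_prop
  refine IndepFun.of_measure_inter_eq_mul (ρ := fun B => ∫⁻ s in B, u s ∂radialMeasure n)
    (τ := fun A => ∫⁻ w in A, v w ∂shapeMeasure n) fun B A hB hA => ?_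
  rw [pi_apply_mean_shape hm (fun x hx => Set.indicator_of_notMem (by simpa using hx) _) hB hA,
    ← lintegral_mul_const _ hum]
  refine lintegral_congr_ae ?_
  filter_upwards [ae_restrict_of_ae ae_radialMeasure_pos] with s hs
  rw [← lintegral_const_mul _ hvm]
  refine lintegral_congr_ae ?_
  filter_upwards [ae_restrict_of_ae (ae_shapeMeasure n)] with w hw
  exact prod_gammaPDF_dilation ha hr hs hw.1 hw.2

/-! ### Identification of the gamma density and conclusion -/

/-- A probability density of the form `exp (e + c log s + d s)` is a gamma density. -/
theorem isGammaDistribution_of_log_density_eq {f : ℝ → ℝ} (hfm : Measurable f)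
    (hf0 : ∀ x ≤ 0, f x = 0) (hfpos : ∀ x, 0 < x → 0 < f x)
    [hP : IsProbabilityMeasure ((volume : Measure ℝ).withDensity fun x => ENNReal.ofReal (f x))]
    {c d e : ℝ} (h : ∀ s, 0 < s → Real.log (f s) = e + c * Real.log s + d * s) :
    IsGammaDistribution ((volume : Measure ℝ).withDensity fun x => ENNReal.ofReal (f x)) := by
  have hfnn : ∀ x, 0 ≤ f x := fun x =>
    (le_or_gt x 0).elim (fun hx => (hf0 x hx).ge) fun hx => (hfpos x hx).le
  have hf : ∀ s, 0 < s → f s = Real.exp e * s ^ c * Real.exp (d * s) := by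
    intro s hs
    rw [← Real.exp_log (hfpos s hs), h s hs, Real.exp_add, Real.exp_add,
      Real.rpow_def_of_pos hs, mul_comm c]
  have hint1 : ∫⁻ x, ENNReal.ofReal (f x) = 1 := by
    have := hP.measure_univ
    rwa [withDensity_apply _ .univ, Measure.restrict_univ] at this
  have hint : Integrable f := by
    refine ⟨hfm.aestronglyMeasurable, ?_⟩
    rw [hasFiniteIntegral_iff_ofReal (ae_of_all _ hfnn), hint1]
    exact ENNReal.one_lt_top
  -- Where `exp (d * s)` is bounded below, integrability of `f` passes to `s ^ c`. On all of `(0,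
  -- ∞)` this excludes `d ≥ 0`; on `(0, 1)` it gives `c > -1`.
  have hdom : ∀ S : Set ℝ, MeasurableSet S → S ⊆ Set.Ioi 0 → ∀ K : ℝ, 0 < K →
      (∀ s ∈ S, K ≤ Real.exp (d * s)) → IntegrableOn (fun s : ℝ => s ^ c) S := by
    intro S hS hS0 K hK hle
    have h1 : IntegrableOn (fun s => (Real.exp e * K)⁻¹ * f s) S :=
      (hint.const_mul _).integrableOn
    refine Integrable.mono' h1 (by fun_prop) ?_
    filter_upwards [ae_restrict_mem hS] with s hs
    have hs0 : 0 < s := hS0 hs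
    rw [Real.norm_of_nonneg (by positivity), hf s hs0, inv_mul_eq_div, le_div_iff₀ (by positivity)]
    calc s ^ c * (Real.exp e * K) = Real.exp e * s ^ c * K := by ring
      _ ≤ _ := mul_le_mul_of_nonneg_left (hle s hs) (by positivity)
  have hd : d < 0 := by
    by_contra! hd
    refine not_integrableOn_Ioi_rpow c (hdom _ measurableSet_Ioi le_rfl 1 one_pos fun s hs => ?_)
    have hs0 : (0 : ℝ) < s := hs
    exact Real.one_le_exp (by positivity)
  have hc : -1 < c := by
    refine (intervalIntegral.integrableOn_Ioo_rpow_iff one_pos).1 (hdom _ measurableSet_Ioo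
      (fun s hs => hs.1) (Real.exp d) (Real.exp_pos d) fun s hs => Real.exp_le_exp.2 ?_)
    nlinarith [hs.2]
  have ha : 0 < c + 1 := by linarith
  have hr : 0 < -d := by linarith
  have hG := Real.Gamma_pos_of_pos ha
  refine ⟨c + 1, (-d)⁻¹, ha, inv_pos.2 hr, ?_⟩
  rw [inv_inv]
  -- The ratio of the gamma density to `f`; it is one because both have total mass one.
  set C : ℝ := (-d) ^ (c + 1) / Real.Gamma (c + 1) / Real.exp e with hC
  have hC0 : 0 < C := by positivity
  have hae : gammaPDF (c + 1) (-d) =ᵐ[volume]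
      fun x => ENNReal.ofReal C * ENNReal.ofReal (f x) := by
    have h0 : ∀ᵐ x : ℝ, x ≠ 0 := by simp [ae_iff]
    filter_upwards [h0] with x hx
    rcases lt_or_gt_of_ne hx with hx | hx
    · simp [gammaPDF_of_neg hx, hf0 x hx.le]
    · rw [gammaPDF_of_nonneg hx.le, ← ENNReal.ofReal_mul hC0.le, hf x hx, hC]
      congr 1
      have := (Real.exp_pos e).ne'
      rw [add_sub_cancel_right, neg_mul, neg_neg]
      field_simp
  have h1 := lintegral_gammaPDF_eq_one ha hr
  rw [lintegral_congr_ae hae, lintegral_const_mul _ hfm.ennreal_ofReal, hint1, mul_one] at h1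
  rw [gammaMeasure, withDensity_congr_ae hae, h1]
  simp

/-- The density can be chosen measurable and zero off the open half-line. -/
theorem HasPositiveContinuousDensity.exists_measurable {F : Measure ℝ}
    (hF : HasPositiveContinuousDensity F) : ∃ f : ℝ → ℝ, Measurable f ∧ (∀ x ≤ 0, f x = 0) ∧
      ContinuousOn f (Set.Ioi 0) ∧ (∀ x, 0 < x → 0 < f x) ∧
      F = volume.withDensity fun x => ENNReal.ofReal (f x) := by
  obtain ⟨f, hf, hfpos, rfl⟩ := hF
  refine ⟨(Set.Ioi 0).indicator f, ?_, fun x hx => Set.indicator_of_notMem (by simpa using hx) _,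
    hf.congr fun x hx => Set.indicator_of_mem hx _, fun x hx => ?_, ?_⟩
  · rw [← Set.piecewise_eq_indicator]
    exact hf.measurable_piecewise continuousOn_const measurableSet_Ioi
  · rw [Set.indicator_of_mem (Set.mem_Ioi.2 hx)]; exact hfpos x hx
  · rw [← withDensity_indicator measurableSet_Ioi]
    congr 1
    ext x
    by_cases hx : x ∈ Set.Ioi (0 : ℝ) <;> simp [hx, Set.indicator]

theorem isSpread_weightedSpread {n : ℕ} (hn : 0 < n) {p : ℝ} (hp : 0 < p)
    {a : Fin n → Fin n → ℝ} (ha : ∀ i j, 0 ≤ a i j)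
    (ha1n : 0 < a ⟨0, hn⟩ ⟨n - 1, by omega⟩ + a ⟨n - 1, by omega⟩ ⟨0, hn⟩) :
    IsSpread fun x => weightedSpread a p x ^ (1 / p) where
  measurable := (measurable_weightedSpread a p).pow_const _
  smul _ hc x := weightedSpread_rpow_smul hp ha hc x
  tendsto := tendsto_weightedSpread_one hp
  exists_le_imp_mem _ hU := exists_weightedSpread_le_imp_mem hn hp ha ha1n hU

theorem corollary4 {Ω : Type*} [MeasurableSpace Ω] (P : Measure Ω) [IsProbabilityMeasure P]
    (n : ℕ) (hn : 3 ≤ n)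
    (F : Measure ℝ) [IsProbabilityMeasure F] (hF : HasPositiveContinuousDensity F)
    (X : Fin n → Ω → ℝ) (hlaw : ∀ i, HasLaw (X i) F P) (hindep : iIndepFun X P)
    (p : ℝ) (hp : 0 < p)
    (a : Fin n → Fin n → ℝ) (ha : ∀ i j, 0 ≤ a i j)
    (ha1n : 0 < a ⟨0, by omega⟩ ⟨n - 1, by omega⟩ + a ⟨n - 1, by omega⟩ ⟨0, by omega⟩) :
    IndepFun (fun ω => sampleMean (fun i => X i ω))
      (fun ω => weightedSpread a p (fun i => X i ω) ^ (1 / p) / sampleMean (fun i => X i ω)) P ↔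
    IsGammaDistribution F := by
  have : NeZero n := ⟨by omega⟩
  have hT := isSpread_weightedSpread (by omega) hp ha ha1n
  have hmap : P.map (fun ω i => X i ω) = Measure.pi fun _ => F := by
    rw [(iIndepFun_iff_map_fun_eq_pi_map fun i => (hlaw i).aemeasurable).1 hindep]
    simp only [(hlaw _).map_eq]
  have hFpos : ∀ᵐ x ∂F, 0 < x := by
    obtain ⟨f, -, -, rfl⟩ := hF
    exact (withDensity_absolutelyContinuous _ _).ae_le (ae_restrict_mem measurableSet_Ioi)
  rw [indepFun_comp_iff_map (V := fun ω i => X i ω) (Y := sampleMean)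
    (Z := fun x => weightedSpread a p x ^ (1 / p) / sampleMean x)
    (aemeasurable_pi_lambda _ fun i => (hlaw i).aemeasurable) measurable_sampleMean
    (hT.measurable.div measurable_sampleMean), hmap,
    indepFun_sampleMean_div_iff (T := fun x => weightedSpread a p x ^ (1 / p)) hT.smul hFpos]
  constructor
  · intro h
    obtain ⟨f, hfm, hf0, hf, hfpos, rfl⟩ := hF.exists_measurable
    obtain ⟨c, d, e, hlog⟩ := hT.log_density_eq (by omega) hfm hf0 hf hfpos h
    exact isGammaDistribution_of_log_density_eq hfm hf0 hfpos hlog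
  · rintro ⟨α, b, hα, hb, rfl⟩
    -- The ratio has been replaced by a measurable function of the shape, so independence from the
    -- whole shape suffices.
    exact (indepFun_sampleMean_shape_gamma hα (inv_pos.2 hb)).comp measurable_id hT.measurable
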